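/- The Hamming graph $H(N,2)$ is the graph on $\{0,1\}^N$ in which two words are adjacent if and only if they differ in exactly one position. A perfect $2$-coloring of $H(N,2)$ with quotient matrix $(S_{i,j})_{i,j\in\{0,1\}}$ is a surjective map $f:\{0,1\}^N\to\{0,1\}$ such that every vertex of color $i$ has exactly $S_{i,j}$ neighbors of color $j$, for all $i,j\in\{0,1\}$. It has no non-essential arguments if for every position $i$ there are two words $x,y$ differing only in the $i$th position with $f(x)\ne f(y)$. Theorem. Let $b$ and $c$ be positive integers, let $e=\gcd(b,c)$ and let $M=\frac{b+c}{e}$. (a) If $M$ is a power of $2$, then there exists a perfect $2$-coloring of $H(N,2)$ without non-essential arguments and with quotient matrix $$\begin{pmatrix} N-b & b\\ c & N-c\end{pmatrix},\qquad\text{where } N=(2M-1)2^{e-1}-M.$$ (b) If moreover $M\ge 8$ and $M$ is an odd power of $2$ (that is, $M=2^s$ with $s$ odd), then there also exists a perfect $2$-coloring of $H(N,2)$ without non-essential arguments and with quotient matrix $$\begin{pmatrix} N-b & b\\ c & N-c\end{pmatrix},\qquad\text{where } N=M\cdot 2^{e}-M.$$ -/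

import Mathlib

/-- The Hamming graph `H(n, q)`: words of length `n` over an alphabet of size `q`, two words being
adjacent if and only if they differ in exactly one position. -/
def hammingGraph (n q : ℕ) : SimpleGraph (Fin n → Fin q) where
  Adj x y := hammingDist x y = 1
  symm := ⟨fun x y h => by rw [hammingDist_comm]; exact h⟩
  loopless := ⟨fun x h => by simp [hammingDist_self] at h⟩

instance (n q : ℕ) : DecidableRel (hammingGraph n q).Adj :=
  fun x y => inferInstanceAs (Decidable (hammingDist x y = 1))

/-- `f : V → K` is a perfect coloring of the (locally finite) graph `G` with quotient matrix `S`: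
it is onto the set `K` of colors, and every vertex of color `i` has exactly `S i j` neighbors of
color `j`. The entries of `S` are integers so that subtraction in them is not truncated. -/
def IsPerfectColoring {V K : Type*} [DecidableEq K] (G : SimpleGraph V) [G.LocallyFinite]
    (f : V → K) (S : Matrix K K ℤ) : Prop :=
  Function.Surjective f ∧
    ∀ (x : V) (j : K), (((G.neighborFinset x).filter (fun y => f y = j)).card : ℤ) = S (f x) j

/-- `f` depends essentially on its `i`th argument: there are two words that differ in the `i`th
position only and at which `f` takes different values. -/
def DependsEssentially {n q : ℕ} {K : Type*} (f : (Fin n → Fin q) → K) (i : Fin n) : Prop :=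
  ∃ x y : Fin n → Fin q, (∀ k, x k ≠ y k ↔ k = i) ∧ f x ≠ f y

/-!
Let `G` be an elementary abelian `2`-group of order `M`. The colorings come from maps
`F : {0,1}^ι → G` that are *balanced* of multiplicity `e`: every word has exactly `e` neighbors of
each color other than its own. Merging the colors in a set `A ⊆ G` of size `b / e` into one, and the
remaining `c / e` colors into the other, gives a perfect `2`-coloring with the required quotient
matrix (`IsBalanced.isPerfectColoring`). As `b / e` and `c / e` are coprime with sum a power of `2`,
the size of `A` is odd, so `A` is not invariant under any nonzero translation of `G`
(`eq_zero_of_translation_invariant`); this is what makes all arguments essential.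

Balanced maps of multiplicity `1` are obtained in two ways.
* For (a), `F` is the syndrome map of the Hamming code, in `M - 1` variables.
* For (b), `F` has `M` variables, and every word is to have exactly one neighbor of each color. For
  words of even weight this only involves the colors of the words of odd weight, and vice versa, so
  `F` can be chosen independently on the two halves. It is
  the syndrome map of the extended Hamming code on even words, and the same map with two columns
  exchanged on odd words (`twistedSyndrome`). Had the columns not been exchanged, the zero column
  would be a non-essential argument. For `M ≥ 8` there is a codeword of weight `4` which meets the
  two exchanged positions once (`exists_even_word`), and adding it changes the color of odd words but
  not of even ones; hence the twist makes every argument essential.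

The multiplicity is raised by one, and the number `N` of variables replaced by `2 N + M`, by
`F' (x, y, z) = F (x or y, according to the parity of z) + syndrome z` (`doubling`): changing `z` in
one position yields every color exactly once, changing the selected one of `x`, `y` yields every
other color `e` times, and changing the other one does not affect the color.
-/

open Finset

/-! ### Words and syndromes -/

section Words

variable {ι G : Type*} [DecidableEq ι]

/-- The word `x` with its `i`th letter changed. -/
def flipAt (x : ι → Fin 2) (i : ι) : ι → Fin 2 := Function.update x i (x i + 1)

lemma fin_two_ne_iff (a b : Fin 2) : a ≠ b ↔ b = a + 1 := by revert a b; decide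

lemma flipAt_ne_iff (x : ι → Fin 2) (i k : ι) : x k ≠ flipAt x i k ↔ k = i := by
  by_cases h : k = i
  · subst h; simp [flipAt]
  · simp [flipAt, h]

lemma flipAt_injective (x : ι → Fin 2) : Function.Injective (flipAt x) := by
  intro i j h
  have := (flipAt_ne_iff x i i).2 rfl
  rw [h] at this
  exact (flipAt_ne_iff x j i).1 this

lemma flipAt_comp_self {κ : Type*} [DecidableEq κ] {g : κ → ι} (hg : Function.Injective g)
    (x : ι → Fin 2) (k : κ) : flipAt x (g k) ∘ g = flipAt (x ∘ g) k :=
  Function.update_comp_eq_of_injective x hg k _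

lemma flipAt_comp_of_notMem_range {κ : Type*} {g : κ → ι} (x : ι → Fin 2) {i : ι}
    (hi : ∀ k, g k ≠ i) : flipAt x i ∘ g = x ∘ g := by
  funext k
  simp [flipAt, hi k]

lemma flipAt_comp_equiv {κ : Type*} [DecidableEq κ] (ε : κ ≃ ι) (x : ι → Fin 2) (i : ι) :
    flipAt x i ∘ ε = flipAt (x ∘ ε) (ε.symm i) := by
  rw [← flipAt_comp_self ε.injective, ε.apply_symm_apply]

end Words

section Syndromes

variable {ι G : Type*} [Fintype ι] [AddCommGroup G]

/-- The sum of the columns `col i` over the positions `i` at which `x` has the letter `1`, that is,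
the syndrome of `x` for the parity-check matrix with these columns. -/
def syndrome (col : ι → G) (x : ι → Fin 2) : G := ∑ i, if x i = 1 then col i else 0

lemma syndrome_zero (col : ι → G) : syndrome col 0 = 0 := by simp [syndrome]

/-- The parity of the weight of a word. -/
def parity (x : ι → Fin 2) : ZMod 2 := syndrome (fun _ => 1) x

lemma parity_zero : parity (0 : ι → Fin 2) = 0 := syndrome_zero _

variable [DecidableEq ι]

lemma syndrome_flipAt (hG : ∀ g : G, g + g = 0) (col : ι → G) (x : ι → Fin 2) (i : ι) :
    syndrome col (flipAt x i) = syndrome col x + col i := by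
  unfold syndrome
  rw [← add_sum_erase _ _ (mem_univ i), ← add_sum_erase _ (fun k => if x k = 1 then _ else _)
    (mem_univ i)]
  have h : ∑ k ∈ univ.erase i, (if flipAt x i k = 1 then col k else 0)
      = ∑ k ∈ univ.erase i, (if x k = 1 then col k else 0) := by
    refine sum_congr rfl fun k hk => ?_
    rw [flipAt, Function.update_of_ne (ne_of_mem_erase hk)]
  rw [h]
  have h2 : x i = 0 ∨ x i = 1 := by
    generalize x i = a; revert a; decide
  rcases h2 with h2 | h2
  · simp [flipAt, h2, add_comm]
  · simp only [flipAt, Function.update_self, h2, if_true]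
    rw [if_neg (by decide), zero_add, add_comm (col i), add_assoc, hG, add_zero]

lemma parity_flipAt (x : ι → Fin 2) (i : ι) : parity (flipAt x i) = parity x + 1 :=
  syndrome_flipAt (by decide) _ x i

end Syndromes

/-! ### Balanced maps and perfect colorings -/

section Balanced

variable {ι G : Type*} [DecidableEq ι]

/-- All arguments of the indicator function of `F x ∈ A` are essential. -/
def AllEssential (A : Finset G) (F : (ι → Fin 2) → G) : Prop :=
  ∀ i, ∃ x, ¬(F x ∈ A ↔ F (flipAt x i) ∈ A)

lemma AllEssential.reindex {κ : Type*} [DecidableEq κ] {A : Finset G} {F : (ι → Fin 2) → G}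
    (hF : AllEssential A F) (ε : ι ≃ κ) : AllEssential A (fun x : κ → Fin 2 => F (x ∘ ε)) := by
  intro k
  obtain ⟨x, hx⟩ := hF (ε.symm k)
  refine ⟨x ∘ ε.symm, ?_⟩
  have h : (x ∘ ε.symm) ∘ ε = x := by funext; simp
  simpa only [flipAt_comp_equiv, h] using hx

variable [Fintype ι] [DecidableEq G]

/-- Every word has exactly `e` neighbors of each color different from its own. -/
def IsBalanced (e : ℕ) (F : (ι → Fin 2) → G) : Prop :=
  ∀ x h, h ≠ F x → #{i | F (flipAt x i) = h} = e

lemma IsBalanced.surjective {e : ℕ} {F : (ι → Fin 2) → G} (hF : IsBalanced e F) (he : 0 < e) :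
    Function.Surjective F := by
  intro h
  by_cases h0 : h = F 0
  · exact ⟨0, h0.symm⟩
  · have := hF 0 h h0
    obtain ⟨i, hi⟩ := card_pos.1 (this ▸ he)
    exact ⟨_, (mem_filter.1 hi).2⟩

lemma IsBalanced.card_filter_mem {e : ℕ} {F : (ι → Fin 2) → G} (hF : IsBalanced e F)
    {A : Finset G} {x : ι → Fin 2} (hx : F x ∉ A) :
    #{i | F (flipAt x i) ∈ A} = e * #A := by
  rw [card_eq_sum_card_fiberwise (s := {i | F (flipAt x i) ∈ A}) (f := fun i => F (flipAt x i))
    (t := A) (fun i hi => (mem_filter.1 hi).2), mul_comm, ← smul_eq_mul, ← sum_const]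
  refine sum_congr rfl fun h hh => ?_
  rw [filter_filter, ← hF x h (fun h' => hx (h' ▸ hh))]
  congr 1
  ext i
  simp only [mem_filter, mem_univ, true_and]
  exact ⟨fun h => h.2, fun h => ⟨h ▸ hh, h⟩⟩

lemma hammingGraph_adj_iff {N : ℕ} (x y : Fin N → Fin 2) :
    (hammingGraph N 2).Adj x y ↔ ∃ i, flipAt x i = y := by
  change #{i | x i ≠ y i} = 1 ↔ _
  rw [card_eq_one]
  refine exists_congr fun i => ?_
  constructor
  · intro h
    funext k
    have hk : x k ≠ y k ↔ k = i := by
      simpa using (Finset.ext_iff.1 h k)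
    by_cases hki : k = i
    · subst hki
      simpa [flipAt] using ((fin_two_ne_iff _ _).1 (hk.2 rfl)).symm
    · simpa [flipAt, hki] using not_not.1 (mt hk.1 hki)
  · rintro rfl
    ext k
    simpa using flipAt_ne_iff x i k

lemma card_neighborFinset_filter {N : ℕ} (x : Fin N → Fin 2) (p : (Fin N → Fin 2) → Prop)
    [DecidablePred p] :
    #(((hammingGraph N 2).neighborFinset x).filter p) = #{i | p (flipAt x i)} := by
  rw [← card_image_of_injective _ (flipAt_injective x)]
  congr 1
  ext y
  simp only [mem_filter, SimpleGraph.mem_neighborFinset, hammingGraph_adj_iff, mem_image, mem_univ,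
    true_and]
  constructor
  · rintro ⟨⟨i, rfl⟩, h⟩; exact ⟨i, h, rfl⟩
  · rintro ⟨i, h, rfl⟩; exact ⟨⟨i, rfl⟩, h⟩

/-- Merging the colors of a balanced map into the two classes `Aᶜ` (color `0`) and `A`
(color `1`). -/
lemma IsBalanced.isPerfectColoring [Fintype G] {N e : ℕ} {F : (Fin N → Fin 2) → G}
    (hF : IsBalanced e F) (he : 0 < e) {A : Finset G} (hA : A.Nonempty) (hA' : Aᶜ.Nonempty) :
    IsPerfectColoring (hammingGraph N 2) (fun x => if F x ∈ A then (1 : Fin 2) else 0)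
      !![(N : ℤ) - (e * #A : ℕ), ((e * #A : ℕ) : ℤ);
         ((e * #Aᶜ : ℕ) : ℤ), (N : ℤ) - (e * #Aᶜ : ℕ)] := by
  refine ⟨fun k => ?_, fun x j => ?_⟩
  · have hk : k = 0 ∨ k = 1 := by revert k; decide
    rcases hk with rfl | rfl
    · obtain ⟨g, hg⟩ := hA'
      obtain ⟨x, rfl⟩ := hF.surjective he g
      exact ⟨x, if_neg (mem_compl.1 hg)⟩
    · obtain ⟨g, hg⟩ := hA
      obtain ⟨x, rfl⟩ := hF.surjective he g
      exact ⟨x, if_pos hg⟩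
  · rw [card_neighborFinset_filter]
    beta_reduce
    have hadd : #{i | F (flipAt x i) ∈ A} + #{i | F (flipAt x i) ∈ Aᶜ} = N := by
      simpa using card_filter_add_card_filter_not (s := univ) (fun i => F (flipAt x i) ∈ A)
    have h1 : #{i | (if F (flipAt x i) ∈ A then (1 : Fin 2) else 0) = 1}
        = #{i | F (flipAt x i) ∈ A} := by
      congr 1; ext i; by_cases h : F (flipAt x i) ∈ A <;> simp [h]
    have h0 : #{i | (if F (flipAt x i) ∈ A then (1 : Fin 2) else 0) = 0}
        = #{i | F (flipAt x i) ∈ Aᶜ} := by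
      congr 1; ext i; by_cases h : F (flipAt x i) ∈ A <;> simp [h]
    have hj : j = 0 ∨ j = 1 := by revert j; decide
    by_cases hx : F x ∈ A
    · have hc := hF.card_filter_mem (A := Aᶜ) (x := x) (by simpa using hx)
      rcases hj with rfl | rfl
      · rw [h0, hc, if_pos hx]; simp
      · rw [h1, if_pos hx, ← hc]
        simp only [Matrix.of_apply, Matrix.cons_val_one, Matrix.cons_val_fin_one]
        omega
    · have hc := hF.card_filter_mem hx
      rcases hj with rfl | rfl
      · rw [h0, if_neg hx, ← hc]
        simp only [Matrix.of_apply, Matrix.cons_val_zero]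
        omega
      · rw [h1, hc, if_neg hx]; simp

lemma AllEssential.dependsEssentially {N : ℕ} {F : (Fin N → Fin 2) → G} {A : Finset G}
    (h : AllEssential A F) (i : Fin N) :
    DependsEssentially (fun x => if F x ∈ A then (1 : Fin 2) else 0) i := by
  obtain ⟨x, hx⟩ := h i
  refine ⟨x, flipAt x i, fun k => flipAt_ne_iff x i k, fun hf => hx ?_⟩
  by_cases h1 : F x ∈ A <;> by_cases h2 : F (flipAt x i) ∈ A <;> simp_all

lemma IsBalanced.reindex {κ : Type*} [DecidableEq κ] [Fintype κ] {e : ℕ} {F : (ι → Fin 2) → G}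
    (hF : IsBalanced e F) (ε : ι ≃ κ) : IsBalanced e (fun x : κ → Fin 2 => F (x ∘ ε)) := by
  intro x h hh
  rw [← hF (x ∘ ε) h hh, ← card_map ε.toEmbedding]
  congr 1
  ext k
  simp [flipAt_comp_equiv]

end Balanced

/-! ### Multiplicity one -/

section Base

variable {G : Type*} [AddCommGroup G]

lemma add_eq_iff_eq_add_of_two_torsion (hG : ∀ g : G, g + g = 0) (a b c : G) :
    a + b = c ↔ b = a + c := by
  constructor
  · rintro rfl; rw [← add_assoc, hG, zero_add]
  · rintro rfl; rw [← add_assoc, hG, zero_add]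

/-- A set of odd size in an elementary abelian `2`-group is invariant under no nonzero translation,
since it would be a union of pairs `{g, g + d}`. -/
lemma eq_zero_of_translation_invariant (hG : ∀ g : G, g + g = 0) {A : Finset G} (hA : Odd #A)
    {d : G} (h : ∀ g, g ∈ A ↔ g + d ∈ A) : d = 0 := by
  by_contra hd
  have : ∑ _g ∈ A, (1 : ZMod 2) = 0 :=
    sum_involution (fun g _ => g + d) (fun _ _ => by decide) (fun g _ _ => by simpa using hd)
      (fun g hg => (h g).1 hg) (fun g _ => by rw [add_assoc, hG, add_zero])
  rw [sum_const, nsmul_one, ZMod.natCast_eq_zero_iff_even] at this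
  exact Nat.not_even_iff_odd.2 hA this

variable [DecidableEq G] [Fintype G]

/-- The syndrome map of the Hamming code, whose columns are the nonzero elements of `G`. -/
lemma isBalanced_syndrome (hG : ∀ g : G, g + g = 0) :
    IsBalanced 1 (syndrome (fun g : {g : G // g ≠ 0} => (g : G))) := by
  intro x h hh
  rw [card_eq_one]
  refine ⟨⟨syndrome (fun g : {g : G // g ≠ 0} => (g : G)) x + h, fun h0 => hh ?_⟩, ?_⟩
  · rw [add_eq_iff_eq_add_of_two_torsion hG, add_zero] at h0
    exact h0
  · ext i
    simp [syndrome_flipAt hG, add_eq_iff_eq_add_of_two_torsion hG, Subtype.ext_iff]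

lemma allEssential_syndrome (hG : ∀ g : G, g + g = 0) {A : Finset G} (hA : Odd #A) :
    AllEssential A (syndrome (fun g : {g : G // g ≠ 0} => (g : G))) := by
  intro i
  by_contra! hi
  refine i.2 (eq_zero_of_translation_invariant hG hA fun g => ?_)
  obtain ⟨x, rfl⟩ := (isBalanced_syndrome hG).surjective one_pos g
  rw [hi x, syndrome_flipAt hG]

/-- The syndrome map of the extended Hamming code (all elements of `G` are columns) on even words;
the same map with the columns `0` and `q` exchanged on odd words. -/
def twistedSyndrome (q : G) (x : G → Fin 2) : G :=
  if parity x = 0 then syndrome id x else syndrome (Equiv.swap 0 q) x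

lemma isBalanced_twistedSyndrome (hG : ∀ g : G, g + g = 0) (q : G) :
    IsBalanced 1 (twistedSyndrome q) := by
  intro x h _
  have key : ∀ (a : G) (π : Equiv.Perm G), #{i | a + π i = h} = 1 := by
    intro a π
    rw [card_eq_one]
    refine ⟨π.symm (a + h), ?_⟩
    ext i
    simp [add_eq_iff_eq_add_of_two_torsion hG, Equiv.eq_symm_apply]
  simp only [twistedSyndrome, parity_flipAt, syndrome_flipAt hG]
  have hp : parity x = 0 ∨ parity x = 1 := by
    generalize parity x = a; revert a; decide
  rcases hp with hp | hp
  · simpa [hp] using key (syndrome (Equiv.swap 0 q) x) (Equiv.swap 0 q)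
  · have h2 : (1 : ZMod 2) + 1 = 0 := by decide
    simp only [hp, h2, if_true]
    exact key (syndrome id x) (Equiv.refl G)

/-- Over a group of order at least `8`, every `v` is the syndrome of an even word that has, at the
position `i`, either of two twisted syndromes differing by `q`. The two words differ by the
codeword of weight `4` supported on a subgroup of order `4` that does not contain `q` if `q ≠ 0`. -/
lemma exists_even_word (hG : ∀ g : G, g + g = 0) (hcard : 8 ≤ Fintype.card G) (q i v : G) : ∃ x y : G → Fin 2, parity x = 0 ∧ parity y = 0 ∧ syndrome id x = syndrome id y ∧
      twistedSyndrome q (flipAt x i) = v ∧ twistedSyndrome q (flipAt y i) = v + q := by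
  obtain ⟨a, ha⟩ : ∃ a, a ∉ ({0, q} : Finset G) := by
    by_contra! h
    have h1 := card_le_card (fun g _ => h g : (univ : Finset G) ⊆ {0, q})
    have h2 := card_le_two (a := 0) (b := q)
    rw [card_univ] at h1
    omega
  obtain ⟨b, hb⟩ : ∃ b, b ∉ ({0, q, a, a + q} : Finset G) := by
    by_contra! h
    have h1 := card_le_card (fun g _ => h g : (univ : Finset G) ⊆ {0, q, a, a + q})
    have h2 := card_le_four (a := 0) (b := q) (c := a) (d := a + q)
    rw [card_univ] at h1
    omega
  simp only [mem_insert, mem_singleton, not_or] at ha hb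
  have hab0 : a + b ≠ 0 := by
    rw [Ne, add_eq_iff_eq_add_of_two_torsion hG, add_zero]; exact hb.2.2.1
  have habq : a + b ≠ q := by
    rw [Ne, add_eq_iff_eq_add_of_two_torsion hG]; exact hb.2.2.2
  have two : (1 : ZMod 2) + 1 = 0 := by decide
  -- `x` is the even word of twisted syndrome `v + π i`, where the column `π 0 = q` that comes from
  -- making the weight even is compensated; `y` is `x` plus the codeword `{0, a, b, a + b}`.
  set π := Equiv.swap 0 q with hπ
  have π0 : π 0 = q := Equiv.swap_apply_left _ _
  have πa : π a = a := Equiv.swap_apply_of_ne_of_ne ha.1 ha.2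
  have πb : π b = b := Equiv.swap_apply_of_ne_of_ne hb.1 hb.2.1
  have πab : π (a + b) = a + b := Equiv.swap_apply_of_ne_of_ne hab0 habq
  let x : G → Fin 2 := flipAt (flipAt 0 0) (π.symm (v + q + π i))
  let y : G → Fin 2 := flipAt (flipAt (flipAt (flipAt x 0) a) b) (a + b)
  have px : parity x = 0 := by simp [x, parity_flipAt, parity_zero, two]
  have py : parity y = 0 := by simp [y, parity_flipAt, px, two]
  refine ⟨x, y, px, py, ?_, ?_, ?_⟩
  · simp only [y, syndrome_flipAt hG, id_eq]
    rw [add_zero, add_assoc, add_assoc, ← add_assoc a b, hG, add_zero]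
  · simp only [twistedSyndrome, parity_flipAt, px, zero_add, one_ne_zero, if_false]
    simp only [x, syndrome_flipAt hG, syndrome_zero, ← hπ, π0, Equiv.apply_symm_apply]
    rw [show 0 + q + (v + q + π i) + π i = v + (q + q) + (π i + π i) by abel, hG, hG, add_zero,
      add_zero]
  · simp only [twistedSyndrome, parity_flipAt, py, zero_add, one_ne_zero, if_false]
    simp only [y, x, syndrome_flipAt hG, syndrome_zero, ← hπ, π0, πa, πb, πab,
      Equiv.apply_symm_apply]
    rw [show 0 + q + (v + q + π i) + q + a + b + (a + b) + π i
      = v + q + (q + q) + (π i + π i) + (a + a) + (b + b) by abel, hG, hG, hG, hG]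
    simp

lemma allEssential_twistedSyndrome (hG : ∀ g : G, g + g = 0) (hcard : 8 ≤ Fintype.card G) {q : G}
    (hq : q ≠ 0) {A : Finset G} (hA : Odd #A) : AllEssential A (twistedSyndrome q) := by
  intro i
  by_contra! hi
  refine hq (eq_zero_of_translation_invariant hG hA fun v => ?_)
  obtain ⟨x, y, px, py, hxy, hx, hy⟩ := exists_even_word hG hcard q i v
  rw [← hx, ← hi x, hx, ← hy, ← hi y, twistedSyndrome, twistedSyndrome, if_pos px, if_pos py, hxy]

end Base

/-! ### Raising the multiplicity -/

section Doubling

variable {ι G : Type*} [DecidableEq ι] [AddCommGroup G] [DecidableEq G] [Fintype G]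

/-- In the concatenation `(x, y, z)`, the parity of `z` selects `x` or `y`; the color of the
selected word is shifted by the syndrome of `z`. -/
def doubling (F : (ι → Fin 2) → G) (w : ι ⊕ ι ⊕ G → Fin 2) : G :=
  F (if parity (w ∘ Sum.inr ∘ Sum.inr) = 0 then w ∘ Sum.inl else w ∘ Sum.inr ∘ Sum.inl)
    + syndrome id (w ∘ Sum.inr ∘ Sum.inr)

variable (F : (ι → Fin 2) → G) (w : ι ⊕ ι ⊕ G → Fin 2)

lemma doubling_flipAt_left (i : ι) : doubling F (flipAt w (Sum.inl i)) =
    F (if parity (w ∘ Sum.inr ∘ Sum.inr) = 0 then flipAt (w ∘ Sum.inl) i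
      else w ∘ Sum.inr ∘ Sum.inl) + syndrome id (w ∘ Sum.inr ∘ Sum.inr) := by
  rw [doubling, flipAt_comp_of_notMem_range w (g := Sum.inr ∘ Sum.inr) (by simp),
    flipAt_comp_of_notMem_range w (g := Sum.inr ∘ Sum.inl) (by simp),
    flipAt_comp_self Sum.inl_injective]

lemma doubling_flipAt_middle (i : ι) : doubling F (flipAt w (Sum.inr (Sum.inl i))) =
    F (if parity (w ∘ Sum.inr ∘ Sum.inr) = 0 then w ∘ Sum.inl
      else flipAt (w ∘ Sum.inr ∘ Sum.inl) i) + syndrome id (w ∘ Sum.inr ∘ Sum.inr) := by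
  rw [doubling, flipAt_comp_of_notMem_range w (g := Sum.inr ∘ Sum.inr) (by simp),
    flipAt_comp_of_notMem_range w (g := Sum.inl) (by simp),
    ← flipAt_comp_self (Sum.inr_injective.comp Sum.inl_injective) w i]
  rfl

lemma doubling_flipAt_right (hG : ∀ g : G, g + g = 0) (g : G) :
    doubling F (flipAt w (Sum.inr (Sum.inr g))) =
    F (if parity (w ∘ Sum.inr ∘ Sum.inr) = 0 then w ∘ Sum.inr ∘ Sum.inl
      else w ∘ Sum.inl) + (syndrome id (w ∘ Sum.inr ∘ Sum.inr) + g) := by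
  have h : flipAt w (Sum.inr (Sum.inr g)) ∘ Sum.inr ∘ Sum.inr
      = flipAt (w ∘ Sum.inr ∘ Sum.inr) g :=
    flipAt_comp_self (g := Sum.inr ∘ Sum.inr) (Sum.inr_injective.comp Sum.inr_injective) w g
  rw [doubling, h, flipAt_comp_of_notMem_range w (g := Sum.inr ∘ Sum.inl) (by simp),
    flipAt_comp_of_notMem_range w (g := Sum.inl) (by simp), parity_flipAt, syndrome_flipAt hG]
  have hp : ∀ p : ZMod 2, p + 1 = 0 ↔ ¬ p = 0 := by decide
  simp only [hp, ite_not, id_eq]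

variable {F}

lemma IsBalanced.doubling [Fintype ι] (hG : ∀ g : G, g + g = 0) {e : ℕ} (hF : IsBalanced e F) :
    IsBalanced (e + 1) (doubling F) := by
  intro w h hh
  rw [card_filter, Fintype.sum_sum_type, Fintype.sum_sum_type]
  simp only [← card_filter, doubling_flipAt_left, doubling_flipAt_middle,
    doubling_flipAt_right F w hG]
  rw [_root_.doubling] at hh
  set z := w ∘ Sum.inr ∘ Sum.inr
  have hz : ∀ u : G, #{g | u + (syndrome id z + g) = h} = 1 := by
    intro u
    rw [card_eq_one]
    refine ⟨syndrome id z + (u + h), ?_⟩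
    ext g
    simp [add_eq_iff_eq_add_of_two_torsion hG]
  have hu : ∀ u : G, u + syndrome id z = h ↔ u = h + syndrome id z := by
    intro u
    rw [add_comm u, add_eq_iff_eq_add_of_two_torsion hG, add_comm h]
  by_cases hp : parity z = 0
  · simp only [hp, if_true] at hh ⊢
    have h1 : h + syndrome id z ≠ F (w ∘ Sum.inl) := fun h' => hh ((hu _).2 h'.symm).symm
    rw [hz]
    simp only [hu, hF _ _ h1, h1.symm]
    simp
  · simp only [hp, if_false] at hh ⊢
    have h1 : h + syndrome id z ≠ F (w ∘ Sum.inr ∘ Sum.inl) :=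
      fun h' => hh ((hu _).2 h'.symm).symm
    rw [hz]
    simp only [hu, hF _ _ h1, h1.symm]
    simp

lemma AllEssential.doubling (hG : ∀ g : G, g + g = 0) {A : Finset G} (hF : AllEssential A F)
    (hs : Function.Surjective F) (hA : A.Nonempty) (hA' : Aᶜ.Nonempty) :
    AllEssential A (doubling F) := by
  rintro (i | i | g)
  · obtain ⟨x, hx⟩ := hF i
    refine ⟨Sum.elim x (Sum.elim x 0), ?_⟩
    rw [doubling_flipAt_left, _root_.doubling]
    simpa [← Function.comp_assoc, parity_zero, syndrome_zero] using hx
  · obtain ⟨y, hy⟩ := hF i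
    -- A word of odd weight and syndrome `0`, which selects `y`.
    refine ⟨Sum.elim y (Sum.elim y (flipAt 0 0)), ?_⟩
    rw [doubling_flipAt_middle, _root_.doubling]
    simpa [← Function.comp_assoc, parity_zero, syndrome_zero, parity_flipAt, syndrome_flipAt hG]
      using hy
  · obtain ⟨a, ha⟩ := hA
    obtain ⟨b, hb⟩ := hA'
    obtain ⟨x, rfl⟩ := hs a
    obtain ⟨y, hy⟩ := hs (b + g)
    refine ⟨Sum.elim x (Sum.elim y 0), ?_⟩
    rw [doubling_flipAt_right _ _ hG, _root_.doubling]
    have : b + g + g = b := by rw [add_assoc, hG, add_zero]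
    simpa [← Function.comp_assoc, parity_zero, syndrome_zero, hy, this, ha] using hb

end Doubling

/-- Iterating `doubling` turns `n₀` variables into `(n₀ + M) 2 ^ k - M`, where `M` is the order
of `G`. -/
lemma exists_isBalanced_of_base {G : Type} [AddCommGroup G] [DecidableEq G] [Fintype G]
    (hG : ∀ g : G, g + g = 0) {A : Finset G} (hA : A.Nonempty) (hA' : Aᶜ.Nonempty)
    {ι₀ : Type} [DecidableEq ι₀] [Fintype ι₀] {F₀ : (ι₀ → Fin 2) → G} (h₀ : IsBalanced 1 F₀)
    (hr₀ : AllEssential A F₀) (k : ℕ) :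
    ∃ (N : ℕ) (F : (Fin N → Fin 2) → G),
      N + Fintype.card G = (Fintype.card ι₀ + Fintype.card G) * 2 ^ k ∧
      IsBalanced (k + 1) F ∧ AllEssential A F := by
  induction k with
  | zero => exact ⟨_, _, by simp, h₀.reindex (Fintype.equivFin ι₀), hr₀.reindex _⟩
  | succ k ih =>
    obtain ⟨N, F, hN, hF, hr⟩ := ih
    refine ⟨_, _, ?_, (hF.doubling hG).reindex (Fintype.equivFin _),
      (hr.doubling hG (hF.surjective k.succ_pos) hA hA').reindex _⟩
    simp only [Fintype.card_sum, Fintype.card_fin]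
    rw [pow_succ, ← mul_assoc, ← hN]
    ring

theorem mainTheorem2 (b c e M : ℕ) (hb : 0 < b) (hc : 0 < c)
    (he : e = Nat.gcd b c) (hM : M = (b + c) / e) (hpow : ∃ s : ℕ, M = 2 ^ s) :
    (∃ N : ℕ, (N : ℤ) = (2 * (M : ℤ) - 1) * 2 ^ (e - 1) - M ∧
      ∃ f : (Fin N → Fin 2) → Fin 2,
        IsPerfectColoring (hammingGraph N 2) f !![(N : ℤ) - b, (b : ℤ); (c : ℤ), (N : ℤ) - c] ∧
        ∀ i : Fin N, DependsEssentially f i) ∧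
    (8 ≤ M → (∃ s : ℕ, Odd s ∧ M = 2 ^ s) →
      ∃ N : ℕ, (N : ℤ) = (M : ℤ) * 2 ^ e - M ∧
        ∃ f : (Fin N → Fin 2) → Fin 2,
          IsPerfectColoring (hammingGraph N 2) f !![(N : ℤ) - b, (b : ℤ); (c : ℤ), (N : ℤ) - c] ∧
          ∀ i : Fin N, DependsEssentially f i) := by
  obtain ⟨s, hs⟩ := hpow
  have he0 : 0 < e := he ▸ Nat.gcd_pos_of_pos_left c hb
  obtain ⟨b', c', hcop, hb', hc'⟩ := Nat.exists_coprime b c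
  rw [← he, mul_comm] at hb' hc'
  have hMbc : b' + c' = M := by
    rw [hM, hb', hc', ← mul_add, Nat.mul_div_cancel_left _ he0]
  have hb0 : 0 < b' := Nat.pos_of_ne_zero fun h => by simp [h] at hb'; omega
  have hc0 : 0 < c' := Nat.pos_of_ne_zero fun h => by simp [h] at hc'; omega
  have hs0 : s ≠ 0 := by rintro rfl; simp at hs; omega
  have hodd : Odd b' := by
    by_contra hev
    rw [Nat.not_odd_iff_even] at hev
    have h2 : 2 ∣ b' + c' := by rw [hMbc, hs]; exact dvd_pow_self 2 hs0
    have h3 : 2 ∣ c' := (Nat.dvd_add_right hev.two_dvd).1 h2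
    have h4 := Nat.dvd_gcd hev.two_dvd h3
    rw [hcop.gcd_eq_one] at h4
    omega
  let G := Fin s → ZMod 2
  have hG : ∀ g : G, g + g = 0 := fun g => by
    funext i
    exact (by decide : ∀ a : ZMod 2, a + a = 0) (g i)
  have hcard : Fintype.card G = M := by simp [G, hs]
  obtain ⟨A, -, hAc⟩ := exists_subset_card_eq (s := (univ : Finset G)) (n := b')
    (by rw [card_univ, hcard]; omega)
  have hAc' : #Aᶜ = c' := by rw [card_compl, hAc, hcard]; omega
  have hA : A.Nonempty := card_pos.1 (hAc ▸ hb0)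
  have hA' : Aᶜ.Nonempty := card_pos.1 (hAc' ▸ hc0)
  have hAodd : Odd #A := hAc ▸ hodd
  have hM0 : 0 < M := by omega
  obtain ⟨k, rfl⟩ : ∃ k, e = k + 1 := ⟨e - 1, by omega⟩
  -- The colorings obtained from a balanced map of multiplicity one in `card ι₀` variables.
  have main : ∀ (ι₀ : Type) [DecidableEq ι₀] [Fintype ι₀] (F₀ : (ι₀ → Fin 2) → G),
      IsBalanced 1 F₀ → AllEssential A F₀ →
      ∃ N : ℕ, N + M = (Fintype.card ι₀ + M) * 2 ^ k ∧ ∃ f : (Fin N → Fin 2) → Fin 2,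
        IsPerfectColoring (hammingGraph N 2) f !![(N : ℤ) - b, (b : ℤ); (c : ℤ), (N : ℤ) - c] ∧
        ∀ i : Fin N, DependsEssentially f i := by
    intro ι₀ _ _ F₀ h₀ hr₀
    obtain ⟨N, F, hN, hF, hr⟩ := exists_isBalanced_of_base hG hA hA' h₀ hr₀ k
    rw [hcard] at hN
    refine ⟨N, hN, _, ?_, hr.dependsEssentially⟩
    have := hF.isPerfectColoring k.succ_pos hA hA'
    rwa [hAc, hAc', ← hb', ← hc'] at this
  refine ⟨?_, fun h8 _ => ?_⟩
  · obtain ⟨N, hN, hf⟩ := main _ _ (isBalanced_syndrome hG) (allEssential_syndrome hG hAodd)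
    refine ⟨N, ?_, hf⟩
    have h1 : Fintype.card {g : G // g ≠ 0} + 1 = M := by
      rw [Fintype.card_subtype_compl, hcard, Fintype.card_unique]; omega
    zify at hN h1
    rw [Nat.add_sub_cancel, eq_sub_iff_add_eq, hN, ← h1]
    ring
  · have : Nontrivial G := Fintype.one_lt_card_iff_nontrivial.1 (by omega)
    obtain ⟨q, hq⟩ := exists_ne (0 : G)
    obtain ⟨N, hN, hf⟩ := main _ _ (isBalanced_twistedSyndrome hG q)
      (allEssential_twistedSyndrome hG (by omega) hq hAodd)
    refine ⟨N, ?_, hf⟩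
    rw [hcard] at hN
    zify at hN
    rw [eq_sub_iff_add_eq, hN]
    ring
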